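/- A Poisson binomial distribution (PBD) of order $n$ with parameters $p_1,\dots,p_n$ is the law of $X_1+\dots+X_n$ for independent $0/1$ Bernoulli variables $X_i$ with $\mathbb{E}[X_i]=p_i$. For an integer $k\ge 1$ its $k$-th power is the PBD of order $n$ with parameters $p_1^k,\dots,p_n^k$. A learning algorithm that draws $N$ samples from the powers of an unknown PBD of order $n$ is a randomized adaptive procedure: $N$ times it chooses an integer $k\ge 1$, depending on its internal randomness and on the samples obtained so far, and receives a fresh independent sample from the $k$-th power; then it returns a vector $\hat p\in\mathbb{R}^n$ depending on its internal randomness and on the $N$ samples. It returns estimates of the parameters within additive error $\varepsilon$ if $|\hat p_{\tau(i)}-p_i|\le\varepsilon$ for all $i$, for some permutation $\tau$ of $\{1,\dots,n\}$. Theorem. There are absolute constants $c>0$ and $\varepsilon_0>0$ such that for all $0<\varepsilon\le\varepsilon_0$ and all integers $n\ge 1/\varepsilon$ the following holds. Any learning algorithm that draws $N$ samples from the powers of a PBD of order $n$ and that, for every parameter vector $p\in(0,1)^n$, returns estimates of the parameters within additive error $\varepsilon$ with probability at least $2/3$ must have $N\ge 2^{c/\varepsilon}$. (This holds with no restriction on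 which powers, or how high powers, are sampled.) -/

import Mathlib

open MeasureTheory ProbabilityTheory
open scoped unitInterval ENNReal

noncomputable section

/-- The Poisson binomial distribution of order `n` with parameters `p 0, …, p (n - 1)`: the law of
`X_1 + ⋯ + X_n` for independent `0/1` Bernoulli variables `X_i` with `P (X_i = 1) = p i`. -/
def poissonBinomial {n : ℕ} (p : Fin n → I) : PMF ℕ :=
  (Measure.pi fun i => bernoulliMeasure (1 : ℕ) 0 (p i)).toPMF.map fun x => ∑ i, x i

/-- The `k`-th power of the Poisson binomial distribution with parameters `p i`: the Poisson
binomial distribution with parameters `(p i) ^ k`. -/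
def pbdPower {n : ℕ} (p : Fin n → I) (k : ℕ+) : PMF ℕ :=
  poissonBinomial fun i => p i ^ (k : ℕ)

/-- A randomized adaptive learning algorithm for the parameters of a Poisson binomial distribution
of order `n`, with sampling access to all its powers. `Ω` carries the internal randomness.
A history is the list of the samples obtained so far, the most recent one first. (For a fixed
`ω : Ω` the history determines which powers have been queried before.) -/
structure PowerLearner (Ω : Type*) [MeasurableSpace Ω] (n : ℕ) where
  /-- the power from which the next sample is requested -/
  query : Ω → List ℕ → ℕ+
  /-- the estimates of the parameters returned at the end -/
  estimate : Ω → List ℕ → Fin n → ℝ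
  measurableSet_query : ∀ h k, MeasurableSet {ω | query ω h = k}
  measurable_estimate : ∀ h, Measurable fun ω => estimate ω h

namespace PowerLearner

variable {Ω : Type*} [MeasurableSpace Ω] {n : ℕ}

/-- The law of the history after `N` samples, for internal randomness `ω`, when the unknown
parameters are `p`: each sample is drawn from the requested power, independently of the past. -/
def history (L : PowerLearner Ω n) (p : Fin n → I) (ω : Ω) : ℕ → PMF (List ℕ)
  | 0 => PMF.pure []
  | N + 1 => (L.history p ω N).bind fun h =>
      (pbdPower p (L.query ω h)).map fun x => x :: h

end PowerLearner

/-- `v` gives the parameters `p` within additive error `ε`. Since a Poisson binomial distribution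
determines its parameters only as a multiset, this is understood up to reordering. -/
def EstimatesWithin {n : ℕ} (v : Fin n → ℝ) (p : Fin n → I) (ε : ℝ) : Prop :=
  ∃ τ : Equiv.Perm (Fin n), ∀ i, |v (τ i) - (p i : ℝ)| ≤ ε

/-- The probability, over the internal randomness and over the `N` samples, that the returned
estimates are within additive error `ε` of the parameters. -/
def PowerLearner.successProb {Ω : Type*} [MeasurableSpace Ω] {n : ℕ} (L : PowerLearner Ω n)
    (P : Measure Ω) (N : ℕ) (ε : ℝ) (p : Fin n → I) : ℝ≥0∞ :=
  ∫⁻ ω, (L.history p ω N).toOuterMeasure {h | EstimatesWithin (L.estimate ω h) p ε} ∂P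

end

/-!
Two parameter vectors are constructed that no estimate within `ε` can serve at once, but all of
whose powers have Poisson binomial distributions at `ℓ¹` distance at most `2 ^ (1 - m)`, for some
`m` of order `1 / ε`. Replacing the samples one at a time (`PowerLearner.tsum_history_mul_le`)
shows that `N` adaptive samples separate them by at most `N * 2 ^ (1 - m)`, so a successful learner
needs `N` to be exponential in `m` (`PowerLearner.successProb_add_le`).

The vectors consist of `(2 + cos θ) / 24` at the `m` angles `θ = 2 π i / m` and at those angles
shifted by `π / m`, respectively, padded with the same values `1 / 2`. A trigonometric polynomial
of degree below `m` has the same sum over both sets of angles, so the power sums of degree below `m`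
agree (`sum_chebyshevParam_pow_eq`). Near `θ = π / 2` the cosine has slope of order one, so the
value `1 / 12` at that angle keeps a distance of order `1 / m` from all values of the second vector
(`le_abs_chebyshevParam_sub`).

For closeness, the generating function of the distribution with parameters `a i ^ k` is
`∏ (1 + a i ^ k (X - 1)) = ∑ e_j(a ^ k) (X - 1) ^ j`, where `e_j` is the elementary symmetric
polynomial. By Newton's identities `e_j(a ^ k)` depends only on the power sums of `a` of degrees up
to `k * j`, so the terms with `k * j < m` cancel in the difference. As the parameters are at most
`1 / 8`, the other terms are exponentially small in `m`, uniformly in the power `k`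
(`coeffNorm_bernoulliPGF_pow_sub_le`).
-/

/-! ### The `ℓ¹` norm of a polynomial -/

section CoeffNorm

open Polynomial

/-- The sum of the absolute values of the coefficients of a real polynomial. -/
def coeffNorm (f : ℝ[X]) : ℝ := ∑ i ∈ f.support, |f.coeff i|

lemma coeffNorm_eq_sum {f : ℝ[X]} {s : Finset ℕ} (h : f.support ⊆ s) :
    coeffNorm f = ∑ i ∈ s, |f.coeff i| :=
  Finset.sum_subset h fun i _ hi => by simpa using hi

lemma coeffNorm_add_le (f g : ℝ[X]) : coeffNorm (f + g) ≤ coeffNorm f + coeffNorm g := by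
  rw [coeffNorm_eq_sum (f := f + g) support_add, coeffNorm_eq_sum (f := f) Finset.subset_union_left,
    coeffNorm_eq_sum (f := g) Finset.subset_union_right, ← Finset.sum_add_distrib]
  exact Finset.sum_le_sum fun i _ => by simpa using abs_add_le (f.coeff i) (g.coeff i)

lemma coeffNorm_sum_le {ι : Type*} (s : Finset ι) (f : ι → ℝ[X]) :
    coeffNorm (∑ i ∈ s, f i) ≤ ∑ i ∈ s, coeffNorm (f i) :=
  Finset.le_sum_of_subadditive _ (by simp [coeffNorm]) coeffNorm_add_le s f

lemma coeffNorm_C_mul (u : ℝ) (f : ℝ[X]) : coeffNorm (C u * f) = |u| * coeffNorm f := by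
  have h : (C u * f).support ⊆ f.support := by
    rw [← smul_eq_C_mul]; exact support_smul u f
  rw [coeffNorm_eq_sum h, coeffNorm, Finset.mul_sum]
  simp [abs_mul]

lemma coeffNorm_mul_X (f : ℝ[X]) : coeffNorm (f * X) = coeffNorm f := by
  have h : (f * X).support ⊆ f.support.map ⟨Nat.succ, Nat.succ_injective⟩ := by
    intro i hi
    rcases i with _ | i
    · simp at hi
    · simpa using hi
  rw [coeffNorm_eq_sum h, Finset.sum_map]
  simp [coeffNorm]

lemma coeffNorm_mul_linear_le (f : ℝ[X]) (u v : ℝ) :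
    coeffNorm (f * (C u + C v * X)) ≤ (|u| + |v|) * coeffNorm f := by
  have h : f * (C u + C v * X) = C u * f + C v * (f * X) := by ring
  rw [h, add_mul]
  refine (coeffNorm_add_le _ _).trans_eq ?_
  rw [coeffNorm_C_mul, coeffNorm_C_mul, coeffNorm_mul_X]

lemma coeffNorm_X_sub_one_pow_le (j : ℕ) : coeffNorm ((X - 1 : ℝ[X]) ^ j) ≤ 2 ^ j := by
  induction j with
  | zero =>
    rw [pow_zero, coeffNorm_eq_sum (s := {0}) (by rw [← C_1]; exact support_C_subset 1)]
    simp
  | succ j ih =>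
    have h : (X - 1 : ℝ[X]) = C (-1) + C 1 * X := by simp; ring
    calc coeffNorm ((X - 1 : ℝ[X]) ^ (j + 1))
        ≤ (|(-1 : ℝ)| + |1|) * coeffNorm ((X - 1 : ℝ[X]) ^ j) := by
          rw [pow_succ]; nth_rewrite 2 [h]; exact coeffNorm_mul_linear_le _ _ _
      _ ≤ 2 ^ (j + 1) := by rw [pow_succ]; norm_num; linarith

end CoeffNorm

/-! ### Probability generating functions -/

section GeneratingFunction

open Polynomial

variable {ι : Type*} [Fintype ι]

/-- The probability generating function `∏ (1 - a i + a i X)` of the Poisson binomial distribution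
with parameters `a i`, written in terms of `X - 1`. -/
noncomputable def bernoulliPGF (a : ι → ℝ) : ℝ[X] := ∏ i, (1 + C (a i) * (X - 1))

lemma one_add_C_mul_X_sub_one (u : ℝ) : (1 + C u * (X - 1) : ℝ[X]) = C (1 - u) + C u * X := by
  simp; ring

lemma bernoulliMeasure_one_zero_singleton (u : I) (b : ℕ) :
    bernoulliMeasure (1 : ℕ) 0 u {b} =
      ENNReal.ofReal (if b = 0 then 1 - u else if b = 1 then (u : ℝ) else 0) := by
  rcases b with _ | _ | b
  · rw [bernoulliMeasure_apply_of_notMem_of_mem u (measurableSet_singleton _) (by simp) (by simp)]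
    exact ENNReal.coe_nnreal_eq _
  · rw [bernoulliMeasure_apply_of_mem_of_notMem u (measurableSet_singleton _) (by simp) (by simp)]
    exact ENNReal.coe_nnreal_eq _
  · rw [bernoulliMeasure_apply_of_notMem_of_notMem u
      (measurableSet_singleton _) (by simp) (by simp)]
    simp

lemma coeff_bernoulliPGF [DecidableEq ι] (a : ι → ℝ) (j : ℕ) :
    (bernoulliPGF a).coeff j = ∑ x ∈ Fintype.piFinset fun _ : ι => ({0, 1} : Finset ℕ),
      if j = ∑ i, x i then ∏ i, (if x i = 0 then 1 - a i else if x i = 1 then a i else 0)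
      else 0 := by
  have h : bernoulliPGF a = ∏ i, ∑ b ∈ ({0, 1} : Finset ℕ),
      C (if b = 0 then 1 - a i else if b = 1 then a i else 0) * X ^ b := by
    refine Finset.prod_congr rfl fun i _ => ?_
    rw [one_add_C_mul_X_sub_one]; simp
  rw [h, Finset.prod_univ_sum, finsetSum_coeff]
  refine Finset.sum_congr rfl fun x _ => ?_
  rw [Finset.prod_mul_distrib, Finset.prod_pow_eq_pow_sum, ← map_prod, coeff_C_mul, coeff_X_pow]
  simp

/-- The polynomial `bernoulliPGF` is the generating function of the Poisson binomial
distribution. -/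
lemma poissonBinomial_apply {n : ℕ} (p : Fin n → I) (j : ℕ) :
    poissonBinomial p j = ENNReal.ofReal ((bernoulliPGF fun i => (p i : ℝ)).coeff j) := by
  have hw : ∀ (i : Fin n) (b : ℕ),
      0 ≤ (if b = 0 then 1 - (p i : ℝ) else if b = 1 then (p i : ℝ) else 0) := by
    intro i b
    have := (p i).2.1
    have := (p i).2.2
    split_ifs <;> linarith
  rw [poissonBinomial, PMF.map_apply, coeff_bernoulliPGF,
    ENNReal.ofReal_sum_of_nonneg fun x _ => by
      split_ifs
      · exact Finset.prod_nonneg fun i _ => hw i _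
      · exact le_rfl,
    tsum_eq_sum (s := Fintype.piFinset fun _ : Fin n => ({0, 1} : Finset ℕ))]
  · refine Finset.sum_congr rfl fun x _ => ?_
    split_ifs
    · rw [Measure.toPMF_apply, Measure.pi_singleton,
        ENNReal.ofReal_prod_of_nonneg fun i _ => hw i _]
      simp_rw [bernoulliMeasure_one_zero_singleton]
    · simp
  · intro x hx
    obtain ⟨i, hi⟩ : ∃ i, x i ≠ 0 ∧ x i ≠ 1 := by simpa using hx
    split_ifs
    · rw [Measure.toPMF_apply, Measure.pi_singleton]
      refine Finset.prod_eq_zero (Finset.mem_univ i) ?_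
      simp [bernoulliMeasure_one_zero_singleton, hi]
    · rfl

/-- Appending further parameters in `[0, 1]` to both sides does not increase the distance. -/
lemma coeffNorm_bernoulliPGF_append_sub_le {m t : ℕ} (a b : Fin m → ℝ) (c : Fin t → ℝ)
    (hc : ∀ i, c i ∈ Set.Icc 0 1) :
    coeffNorm (bernoulliPGF (Fin.append a c) - bernoulliPGF (Fin.append b c)) ≤
      coeffNorm (bernoulliPGF a - bernoulliPGF b) := by
  have key : ∀ (s : Finset (Fin t)) (f : ℝ[X]),
      coeffNorm (f * ∏ i ∈ s, (1 + C (c i) * (X - 1))) ≤ coeffNorm f := by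
    intro s f
    induction s using Finset.induction_on with
    | empty => simp
    | insert i s hi ih =>
      rw [Finset.prod_insert hi, mul_comm (1 + _), ← mul_assoc, one_add_C_mul_X_sub_one]
      refine (coeffNorm_mul_linear_le _ _ _).trans ?_
      rw [abs_of_nonneg (hc i).1, abs_of_nonneg (sub_nonneg.2 (hc i).2)]
      linarith
  refine le_trans (le_of_eq ?_) (key Finset.univ _)
  simp [bernoulliPGF, Fin.prod_univ_add, sub_mul]

/-- In powers of `X - 1`, the coefficients of the generating function are the elementary symmetric
polynomials of the parameters. -/
lemma bernoulliPGF_eq_sum_esymm (a : ι → ℝ) :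
    bernoulliPGF a = ∑ j ∈ Finset.range (Fintype.card ι + 1),
      C (MvPolynomial.aeval a (MvPolynomial.esymm ι ℝ j)) * (X - 1) ^ j := by
  classical
  rw [bernoulliPGF, Finset.prod_one_add, Finset.sum_powerset]
  refine Finset.sum_congr rfl fun j _ => ?_
  rw [MvPolynomial.esymm, map_sum, map_sum, Finset.sum_mul]
  refine Finset.sum_congr rfl fun s hs => ?_
  rw [Finset.prod_mul_distrib, Finset.prod_const, (Finset.mem_powersetCard.1 hs).2]
  simp

/-- Newton's identities: power sums determine the elementary symmetric polynomials. -/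
lemma aeval_esymm_eq_of_sum_pow_eq {a b : ι → ℝ} {j : ℕ}
    (h : ∀ l, 1 ≤ l → l ≤ j → ∑ i, a i ^ l = ∑ i, b i ^ l) :
    MvPolynomial.aeval a (MvPolynomial.esymm ι ℝ j) =
      MvPolynomial.aeval b (MvPolynomial.esymm ι ℝ j) := by
  induction j using Nat.strong_induction_on with
  | _ j ih =>
    rcases Nat.eq_zero_or_pos j with rfl | hj
    · simp [MvPolynomial.esymm_zero]
    · have newton := MvPolynomial.mul_esymm_eq_sum ι ℝ j
      have hj' : (j : ℝ) ≠ 0 := by positivity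
      refine mul_left_cancel₀ hj' ?_
      have ha := congrArg (MvPolynomial.aeval a) newton
      have hb := congrArg (MvPolynomial.aeval b) newton
      simp only [map_mul, map_natCast, map_sum, map_pow, map_neg, map_one] at ha hb
      rw [ha, hb]
      congr 1
      refine Finset.sum_congr rfl fun x hx => ?_
      obtain ⟨hx, hlt⟩ := Finset.mem_filter.1 hx
      have hsum := Finset.HasAntidiagonal.mem_antidiagonal.1 hx
      rw [ih x.1 hlt fun l h1 h2 => h l h1 (by omega)]
      congr 1
      simpa [MvPolynomial.psum] using h x.2 (by omega) (by omega)

lemma abs_aeval_esymm_le {a : ι → ℝ} {ρ : ℝ} (ha : ∀ i, |a i| ≤ ρ) (j : ℕ) :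
    |MvPolynomial.aeval a (MvPolynomial.esymm ι ℝ j)| ≤ (Fintype.card ι).choose j * ρ ^ j := by
  classical
  rw [MvPolynomial.esymm, map_sum]
  refine (Finset.abs_sum_le_sum_abs _ _).trans ?_
  calc ∑ s ∈ Finset.powersetCard j Finset.univ,
        |MvPolynomial.aeval a (∏ i ∈ s, (MvPolynomial.X i : MvPolynomial ι ℝ))|
      ≤ ∑ s ∈ Finset.powersetCard j (Finset.univ : Finset ι), ρ ^ j := by
        refine Finset.sum_le_sum fun s hs => ?_
        rw [map_prod, Finset.abs_prod, ← (Finset.mem_powersetCard.1 hs).2, ← Finset.prod_const]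
        exact Finset.prod_le_prod (fun _ _ => abs_nonneg _) fun i _ => by simpa using ha i
    _ = _ := by simp

/-- If two families of `m` parameters in `[0, 1/8]` have equal power sums of degrees below `m`,
then all their powers have exponentially close Poisson binomial distributions. The elementary
symmetric polynomials of degree `j` of the `k`-th powers agree when `k * j < m`; when `m ≤ k * j`
they are at most `m.choose j * 8 ^ (-k * j)`, which makes up for the norm `2 ^ j` of
`(X - 1) ^ j`. -/
lemma coeffNorm_bernoulliPGF_pow_sub_le {m : ℕ} {a b : Fin m → ℝ}
    (ha : ∀ i, |a i| ≤ 1 / 8) (hb : ∀ i, |b i| ≤ 1 / 8)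
    (hab : ∀ l < m, ∑ i, a i ^ l = ∑ i, b i ^ l) {k : ℕ} (hk : 1 ≤ k) :
    coeffNorm (bernoulliPGF (fun i => a i ^ k) - bernoulliPGF fun i => b i ^ k) ≤
      2 * (1 / 2) ^ m := by
  have hpow : ∀ {c : Fin m → ℝ}, (∀ i, |c i| ≤ 1 / 8) → ∀ i, |c i ^ k| ≤ (1 / 8) ^ k :=
    fun hc i => by rw [abs_pow]; exact pow_le_pow_left₀ (abs_nonneg _) (hc i) k
  rw [bernoulliPGF_eq_sum_esymm, bernoulliPGF_eq_sum_esymm, ← Finset.sum_sub_distrib]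
  simp_rw [← sub_mul, ← C_sub, Fintype.card_fin]
  refine (coeffNorm_sum_le _ _).trans ?_
  have hterm : ∀ j ∈ Finset.range (m + 1),
      coeffNorm (C (MvPolynomial.aeval (fun i => a i ^ k) (MvPolynomial.esymm (Fin m) ℝ j) -
        MvPolynomial.aeval (fun i => b i ^ k) (MvPolynomial.esymm (Fin m) ℝ j)) * (X - 1) ^ j) ≤
      m.choose j * (2 * (1 / 4) ^ m) := by
    intro j _
    rw [coeffNorm_C_mul]
    rcases lt_or_ge (k * j) m with hkj | hkj
    · rw [aeval_esymm_eq_of_sum_pow_eq (b := fun i => b i ^ k)]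
      · simp
      · intro l _ hl
        simp_rw [← pow_mul]
        exact hab _ ((Nat.mul_le_mul_left k hl).trans_lt hkj)
    · have h1 := abs_aeval_esymm_le (hpow ha) j
      have h2 := abs_aeval_esymm_le (hpow hb) j
      rw [Fintype.card_fin] at h1 h2
      have h3 := (abs_sub _ _).trans (add_le_add h1 h2)
      have h4 : ((1 / 8 : ℝ) ^ k) ^ j * 2 ^ j ≤ (1 / 4) ^ m := by
        calc ((1 / 8 : ℝ) ^ k) ^ j * 2 ^ j ≤ (1 / 8) ^ (k * j) * 2 ^ (k * j) := by
              rw [← pow_mul]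
              gcongr
              · norm_num
              · exact Nat.le_mul_of_pos_left j hk
          _ = (1 / 4) ^ (k * j) := by rw [← mul_pow]; norm_num
          _ ≤ (1 / 4) ^ m := pow_le_pow_of_le_one (by norm_num) (by norm_num) hkj
      calc _ ≤ (m.choose j * ((1 / 8 : ℝ) ^ k) ^ j + m.choose j * ((1 / 8 : ℝ) ^ k) ^ j) * 2 ^ j :=
            mul_le_mul h3 (coeffNorm_X_sub_one_pow_le j)
              (Finset.sum_nonneg fun _ _ => abs_nonneg _) (by positivity)
        _ = m.choose j * (2 * (((1 / 8 : ℝ) ^ k) ^ j * 2 ^ j)) := by ring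
        _ ≤ _ := by gcongr
  refine (Finset.sum_le_sum hterm).trans_eq ?_
  rw [← Finset.sum_mul, ← Nat.cast_sum, Nat.sum_range_choose]
  push_cast
  rw [mul_left_comm, ← mul_pow]
  norm_num

end GeneratingFunction

/-! ### Learners that see nearby distributions -/

section Hybrid

/-- The expectation of a function with values in `[0, 1]` changes by at most `δ` between
distributions with truncated pointwise differences of total mass at most `δ`. -/
lemma PMF.tsum_mul_le_add {α : Type*} (D D' : PMF α) {g : α → ℝ≥0∞} (hg : ∀ x, g x ≤ 1)
    {δ : ℝ≥0∞} (h : ∑' x, (D x - D' x) ≤ δ) :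
    ∑' x, D x * g x ≤ ∑' x, D' x * g x + δ := by
  calc ∑' x, D x * g x ≤ ∑' x, (D' x * g x + (D x - D' x)) := by
        refine ENNReal.tsum_le_tsum fun x => ?_
        calc D x * g x ≤ (D' x + (D x - D' x)) * g x := by gcongr; exact le_add_tsub
          _ ≤ D' x * g x + (D x - D' x) := by
              rw [add_mul]; gcongr; exact mul_le_of_le_one_right' (hg x)
    _ ≤ _ := by rw [ENNReal.tsum_add]; gcongr

lemma PMF.tsum_bind_mul {α β : Type*} (D : PMF α) (f : α → PMF β) (g : β → ℝ≥0∞) :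
    ∑' y, D.bind f y * g y = ∑' x, D x * ∑' y, f x y * g y := by
  simp_rw [PMF.bind_apply, ← ENNReal.tsum_mul_right, ← ENNReal.tsum_mul_left]
  rw [ENNReal.tsum_comm]
  simp_rw [mul_assoc]

lemma PMF.tsum_map_mul {α β : Type*} (D : PMF α) (f : α → β) (g : β → ℝ≥0∞) :
    ∑' y, D.map f y * g y = ∑' x, D x * g (f x) := by
  rw [← PMF.bind_pure_comp, PMF.tsum_bind_mul]
  refine tsum_congr fun x => ?_
  rw [tsum_eq_single (f x) fun y hy => by simp [hy]]
  simp

/-- If every power of `p` is within `δ` of the same power of `q`, then after `N` adaptive samples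
the expectations of a bounded function of the history differ by at most `N * δ`: the samples are
replaced one after the other. -/
lemma PowerLearner.tsum_history_mul_le {Ω : Type*} [MeasurableSpace Ω] {n : ℕ}
    (L : PowerLearner Ω n) (p q : Fin n → I) (ω : Ω) {δ : ℝ≥0∞}
    (h : ∀ k, ∑' x, (pbdPower p k x - pbdPower q k x) ≤ δ) (N : ℕ) {g : List ℕ → ℝ≥0∞}
    (hg : ∀ s, g s ≤ 1) :
    ∑' s, L.history p ω N s * g s ≤ ∑' s, L.history q ω N s * g s + N * δ := by
  induction N generalizing g with
  | zero => simp [PowerLearner.history]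
  | succ N ih =>
    have hG : ∀ s, ∑' x, pbdPower q (L.query ω s) x * g (x :: s) ≤ 1 := fun s =>
      (ENNReal.tsum_le_tsum fun x => mul_le_of_le_one_right' (hg _)).trans_eq (PMF.tsum_coe _)
    simp only [PowerLearner.history, PMF.tsum_bind_mul, PMF.tsum_map_mul]
    calc ∑' s, L.history p ω N s * ∑' x, pbdPower p (L.query ω s) x * g (x :: s)
        ≤ ∑' s, (L.history p ω N s * ∑' x, pbdPower q (L.query ω s) x * g (x :: s) +
            L.history p ω N s * δ) := by
          refine ENNReal.tsum_le_tsum fun s => ?_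
          rw [← mul_add]
          gcongr
          exact PMF.tsum_mul_le_add _ _ (fun x => hg _) (h _)
      _ = ∑' s, L.history p ω N s * ∑' x, pbdPower q (L.query ω s) x * g (x :: s) + δ := by
          rw [ENNReal.tsum_add, ENNReal.tsum_mul_right, PMF.tsum_coe, one_mul]
      _ ≤ (∑' s, L.history q ω N s * ∑' x, pbdPower q (L.query ω s) x * g (x :: s) + N * δ) +
            δ := by
          gcongr; exact ih hG
      _ = _ := by push_cast; ring

/-- Le Cam's two-point bound: if no vector estimates both `p` and `q`, the two success
probabilities cannot exceed `1` in total by more than the distance of the histories. -/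
lemma PowerLearner.successProb_add_le {Ω : Type*} [MeasurableSpace Ω] {n : ℕ}
    (L : PowerLearner Ω n) (P : Measure Ω) [IsProbabilityMeasure P] (p q : Fin n → I) {δ : ℝ≥0∞}
    (h : ∀ k, ∑' x, (pbdPower p k x - pbdPower q k x) ≤ δ) (N : ℕ) {ε : ℝ}
    (hpq : ∀ v, EstimatesWithin v p ε → ¬ EstimatesWithin v q ε) :
    L.successProb P N ε p + L.successProb P N ε q ≤ 1 + N * δ := by
  classical
  -- Superadditivity of the lower integral holds without measurability.
  refine (le_lintegral_add _ _).trans ?_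
  calc _ ≤ ∫⁻ _, (1 + N * δ) ∂P := by
        refine lintegral_mono fun ω => ?_
        have hind : ∀ (r : Fin n → I) (A : Set (List ℕ)), (L.history r ω N).toOuterMeasure A =
            ∑' s, L.history r ω N s * A.indicator 1 s := fun r A => by
          rw [PMF.toOuterMeasure_apply]
          exact tsum_congr fun s => by by_cases hs : s ∈ A <;> simp [hs]
        have hle := L.tsum_history_mul_le p q ω h N
          (g := {s | EstimatesWithin (L.estimate ω s) p ε}.indicator 1)
          fun s => Set.indicator_le_self _ _ s
        simp only [hind]
        refine (add_le_add_left hle _).trans ?_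
        rw [add_right_comm, ← ENNReal.tsum_add]
        gcongr
        rw [← (L.history q ω N).tsum_coe]
        refine ENNReal.tsum_le_tsum fun s => ?_
        by_cases hs : EstimatesWithin (L.estimate ω s) p ε
        · simp [Set.indicator, hs, hpq _ hs]
        · by_cases hs' : EstimatesWithin (L.estimate ω s) q ε <;> simp [Set.indicator, hs, hs']
    _ = _ := by simp

end Hybrid

/-! ### Two parameter vectors with equal low power sums -/

section Chebyshev

open Real

/-- Over a full period of `m` equally spaced angles, `cos (j θ)` sums to zero for `0 < |j| < m`. -/
lemma sum_cos_int_mul_eq_zero {m : ℕ} (φ : ℝ) {j : ℤ} (h0 : j ≠ 0) (hj : |j| < m) :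
    ∑ i ∈ Finset.range m, cos (j * (2 * π * i / m + φ)) = 0 := by
  have hm : 0 < m := by have := abs_nonneg j; omega
  have hm' : (m : ℝ) ≠ 0 := by positivity
  -- Multiplied by `2 sin (π j / m)`, the sum telescopes.
  have hs : sin (π * j / m) ≠ 0 := by
    rw [Ne, sin_eq_zero_iff]
    rintro ⟨z, hz⟩
    have hz' : (z * m : ℝ) = j := by
      field_simp at hz
      exact hz
    have hz'' : z * m = j := by exact_mod_cast hz'
    have hz0 : z ≠ 0 := by rintro rfl; simp at hz''; exact h0 hz''.symm
    have : (m : ℤ) ≤ |j| := by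
      rw [← hz'', abs_mul, Nat.abs_cast]
      exact le_mul_of_one_le_left (by positivity) (Int.one_le_abs hz0)
    omega
  have htel : ∀ i : ℕ, 2 * sin (π * j / m) * cos (j * (2 * π * i / m + φ)) =
      sin (j * (2 * π * (i + 1 : ℕ) / m + φ) - π * j / m) -
        sin (j * (2 * π * i / m + φ) - π * j / m) := by
    intro i
    have : (j : ℝ) * (2 * π * (i + 1 : ℕ) / m + φ) - π * j / m =
        j * (2 * π * i / m + φ) + π * j / m := by push_cast; field_simp; ring
    rw [this, sin_add, sin_sub]
    ring
  refine (mul_eq_zero.1 ?_).resolve_left (mul_ne_zero two_ne_zero hs)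
  rw [Finset.mul_sum, Finset.sum_congr rfl fun i _ => htel i,
    Finset.sum_range_sub fun i : ℕ => sin ((j : ℝ) * (2 * π * i / m + φ) - π * j / m)]
  have : (j : ℝ) * (2 * π * m / m + φ) - π * j / m =
      (j * (2 * π * (0 : ℕ) / m + φ) - π * j / m) + j * (2 * π) := by
    push_cast; field_simp; ring
  rw [this, sin_add_int_mul_two_pi, sub_self]

/-- Shifting all angles does not change sums of trigonometric polynomials of degree below `m`. -/
lemma sum_pow_mul_cos_eq {m : ℕ} (φ : ℝ) (l : ℕ) (j : ℤ) (h : l + |j| < m) :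
    ∑ i ∈ Finset.range m, (2 + cos (2 * π * i / m + φ)) ^ l * cos (j * (2 * π * i / m + φ)) =
      ∑ i ∈ Finset.range m, (2 + cos (2 * π * i / m)) ^ l * cos (j * (2 * π * i / m)) := by
  induction l generalizing j with
  | zero =>
    rcases eq_or_ne j 0 with rfl | hj
    · simp
    · have h' : |j| < m := by simpa using h
      have := sum_cos_int_mul_eq_zero 0 hj h'
      simp only [add_zero] at this
      simp [sum_cos_int_mul_eq_zero φ hj h', this]
  | succ l ih =>
    have key : ∀ θ : ℝ, (2 + cos θ) ^ (l + 1) * cos (j * θ) =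
        2 * ((2 + cos θ) ^ l * cos (j * θ)) +
        1 / 2 * ((2 + cos θ) ^ l * cos ((j + 1 : ℤ) * θ)) +
        1 / 2 * ((2 + cos θ) ^ l * cos ((j - 1 : ℤ) * θ)) := by
      intro θ
      push_cast
      rw [add_mul, sub_mul, one_mul, cos_add, cos_sub]
      ring
    have h1 := abs_add_le j 1
    have h2 := abs_sub j 1
    rw [abs_one] at h1 h2
    push_cast at h
    simp_rw [key, Finset.sum_add_distrib, ← Finset.mul_sum]
    rw [ih j (by omega), ih (j + 1) (by omega), ih (j - 1) (by omega)]

/-- The parameters `(2 + cos θ) / 24` at the angles `θ = 2 π i / m + φ` for `i < m`. For `φ = 0` and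
`φ = π / m` the values `cos θ` are the solutions of `T_m = 1` and `T_m = -1`, respectively, where
`T_m` is the Chebyshev polynomial. -/
noncomputable def chebyshevParam (m : ℕ) (φ : ℝ) (i : Fin m) : ℝ :=
  (2 + cos (2 * π * (i : ℕ) / m + φ)) / 24

lemma chebyshevParam_pos {m : ℕ} (φ : ℝ) (i : Fin m) : 0 < chebyshevParam m φ i := by
  have := neg_one_le_cos (2 * π * (i : ℕ) / m + φ)
  unfold chebyshevParam
  linarith

lemma chebyshevParam_le {m : ℕ} (φ : ℝ) (i : Fin m) : chebyshevParam m φ i ≤ 1 / 8 := by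
  have := cos_le_one (2 * π * (i : ℕ) / m + φ)
  unfold chebyshevParam
  linarith

lemma sum_chebyshevParam_pow_eq {m : ℕ} (φ : ℝ) {l : ℕ} (hl : l < m) :
    ∑ i, chebyshevParam m φ i ^ l = ∑ i, chebyshevParam m 0 i ^ l := by
  have h := sum_pow_mul_cos_eq (m := m) φ l 0 (by simpa using hl)
  simp only [Int.cast_zero, zero_mul, cos_zero, mul_one] at h
  simp only [chebyshevParam, div_pow, add_zero, ← Finset.sum_div]
  rw [Fin.sum_univ_eq_sum_range fun i => (2 + cos (2 * π * i / m + φ)) ^ l, h,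
    Fin.sum_univ_eq_sum_range fun i => (2 + cos (2 * π * i / m)) ^ l]

/-- At the angle `π / 2` the unshifted parameter is `1 / 12`; the shifted angles are odd multiples
of `π / (4 r)` away from the zeros of the cosine. -/
lemma le_abs_chebyshevParam_sub {r : ℕ} (hr : 0 < r) (i : Fin (4 * r)) :
    1 / (48 * r : ℝ) ≤ |1 / 12 - chebyshevParam (4 * r) (π / (4 * r : ℕ)) i| := by
  have hr' : (0 : ℝ) < r := by exact_mod_cast hr
  have hi := i.2
  obtain ⟨z, hz⟩ : ∃ z : ℤ, z = 2 * (i : ℕ) + 1 - 2 * r := ⟨_, rfl⟩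
  have hcos : cos (2 * π * (i : ℕ) / (4 * r : ℕ) + π / (4 * r : ℕ)) = -sin (z * (π / (4 * r))) := by
    rw [← cos_add_pi_div_two, hz]
    congr 1
    push_cast
    field_simp
    ring
  suffices h : 1 / (2 * r : ℝ) ≤ |sin (z * (π / (4 * r)))| by
    rw [chebyshevParam, hcos]
    have : (1 / 12 - (2 + -sin (z * (π / (4 * r)))) / 24 : ℝ) = sin (z * (π / (4 * r))) / 24 := by
      ring
    rw [this, abs_div, abs_of_pos (by norm_num : (0 : ℝ) < 24), le_div_iff₀ (by norm_num)]
    refine le_trans (le_of_eq ?_) h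
    field_simp
    norm_num
  have hsin : ∀ w : ℤ, w ≠ 0 → |w| ≤ 2 * r → 1 / (2 * r : ℝ) ≤ |sin (w * (π / (4 * r)))| := by
    intro w hw hwr
    have hw1 : (1 : ℝ) ≤ |(w : ℝ)| := by exact_mod_cast Int.one_le_abs hw
    have hw2 : |(w : ℝ)| ≤ 2 * r := by exact_mod_cast hwr
    have habs : |(w : ℝ) * (π / (4 * r))| = |(w : ℝ)| * (π / (4 * r)) := by
      rw [abs_mul, abs_of_pos (by positivity : 0 < π / (4 * r))]
    refine le_trans ?_ (mul_abs_le_abs_sin ?_)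
    · rw [habs]
      calc 1 / (2 * r : ℝ) ≤ |(w : ℝ)| / (2 * r) := by gcongr
        _ = _ := by field_simp; norm_num
    · rw [habs]
      calc |(w : ℝ)| * (π / (4 * r)) ≤ 2 * r * (π / (4 * r)) := by gcongr
        _ = π / 2 := by field_simp; norm_num
  rcases le_or_gt z (2 * r) with hzr | hzr
  · exact hsin z (by omega) (abs_le.2 ⟨by omega, hzr⟩)
  · -- Angles beyond `π / 2` are reflected at it.
    have h := hsin (4 * r - z) (by omega) (abs_le.2 ⟨by omega, by omega⟩)
    rwa [show ((4 * r - z : ℤ) : ℝ) * (π / (4 * r)) = π - z * (π / (4 * r)) by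
      push_cast; field_simp, sin_pi_sub] at h

end Chebyshev

/-! ### The sample complexity bound -/

lemma tsum_pbdPower_sub_le {n : ℕ} (p q : Fin n → I) (k : ℕ+) :
    ∑' x, (pbdPower p k x - pbdPower q k x) ≤ ENNReal.ofReal (coeffNorm
      (bernoulliPGF (fun i => (p i : ℝ) ^ (k : ℕ)) -
        bernoulliPGF fun i => (q i : ℝ) ^ (k : ℕ))) := by
  set f := bernoulliPGF fun i => (p i : ℝ) ^ (k : ℕ)
  set g := bernoulliPGF fun i => (q i : ℝ) ^ (k : ℕ)
  have hle : ∀ x, pbdPower p k x - pbdPower q k x ≤ ENNReal.ofReal |(f - g).coeff x| := by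
    intro x
    simp only [pbdPower, poissonBinomial_apply, Set.Icc.coe_pow]
    rw [tsub_le_iff_right]
    refine (ENNReal.ofReal_le_ofReal ?_).trans ENNReal.ofReal_add_le
    rw [Polynomial.coeff_sub]
    linarith [le_abs_self (f.coeff x - g.coeff x)]
  refine (ENNReal.tsum_le_tsum hle).trans_eq ?_
  rw [coeffNorm, ENNReal.ofReal_sum_of_nonneg fun _ _ => abs_nonneg _]
  exact tsum_eq_sum fun x hx => by simp [Polynomial.notMem_support_iff.1 hx]

/-- The two-point construction: `4 r` Chebyshev parameters, at unshifted and at shifted angles, and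
the same further parameters `1 / 2` on both sides. -/
lemma exists_indistinguishable_params {r n : ℕ} (hr : 0 < r) (hn : 4 * r ≤ n) {ε : ℝ}
    (hε : 2 * ε < 1 / (48 * r)) (hε' : 2 * ε < 5 / 12) :
    ∃ p q : Fin n → I, (∀ i, 0 < p i ∧ p i < 1) ∧ (∀ i, 0 < q i ∧ q i < 1) ∧
      (∀ v, EstimatesWithin v p ε → ¬ EstimatesWithin v q ε) ∧
      ∀ k, ∑' x, (pbdPower p k x - pbdPower q k x) ≤ ENNReal.ofReal (2 * (1 / 2) ^ (4 * r)) := by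
  obtain ⟨t, rfl⟩ := Nat.exists_eq_add_of_le hn
  obtain ⟨φ, hφ⟩ : ∃ φ, φ = Real.pi / (4 * r : ℕ) := ⟨_, rfl⟩
  have hmem : ∀ (ψ : ℝ) (i : Fin (4 * r + t)), Fin.append (chebyshevParam (4 * r) ψ)
      (fun _ : Fin t => 1 / 2) i ∈ Set.Ioo (0 : ℝ) 1 := by
    intro ψ i
    refine Fin.addCases (fun i => ?_) (fun i => ?_) i
    · rw [Fin.append_left]
      exact ⟨chebyshevParam_pos ψ i, (chebyshevParam_le ψ i).trans_lt (by norm_num)⟩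
    · rw [Fin.append_right]; norm_num
  have habs : ∀ (ψ : ℝ) (i : Fin (4 * r)), |chebyshevParam (4 * r) ψ i| ≤ 1 / 8 := fun ψ i => by
    rw [abs_of_pos (chebyshevParam_pos ψ i)]; exact chebyshevParam_le ψ i
  let P : ℝ → Fin (4 * r + t) → I := fun ψ i => ⟨_, Set.Ioo_subset_Icc_self (hmem ψ i)⟩
  have hP : ∀ ψ i, 0 < P ψ i ∧ P ψ i < 1 := fun ψ i => hmem ψ i
  have hpow : ∀ (ψ : ℝ) (k : ℕ), (fun i => (P ψ i : ℝ) ^ k) =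
      Fin.append (fun i => chebyshevParam (4 * r) ψ i ^ k) fun _ : Fin t => (1 / 2) ^ k := by
    intro ψ k
    funext i
    refine Fin.addCases (fun i => ?_) (fun i => ?_) i
    · simp only [P, Fin.append_left]
    · simp only [P, Fin.append_right]
  refine ⟨P 0, P φ, hP 0, hP φ, ?_, fun k => ?_⟩
  · rintro v ⟨τ, hτ⟩ ⟨τ', hτ'⟩
    -- The parameter `1 / 12` of the first vector would have to be close to one of the second.
    let i₀ : Fin (4 * r) := ⟨r, by omega⟩
    have h0 : (P 0 (Fin.castAdd t i₀) : ℝ) = 1 / 12 := by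
      have hr' : (r : ℝ) ≠ 0 := by positivity
      have harg : 2 * Real.pi * (r : ℝ) / (4 * r : ℕ) = Real.pi / 2 := by
        push_cast; field_simp; norm_num
      simp only [P, Fin.append_left, chebyshevParam, i₀, add_zero, harg, Real.cos_pi_div_two]
      norm_num
    have h1 := hτ (Fin.castAdd t i₀)
    obtain ⟨j, hj⟩ : ∃ j, τ' j = τ (Fin.castAdd t i₀) := τ'.surjective _
    have h2 := hτ' j
    rw [hj] at h2
    rw [h0] at h1
    have hclose : |1 / 12 - (P φ j : ℝ)| ≤ 2 * ε := by
      rw [abs_sub_comm] at h1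
      exact (abs_sub_le _ (v (τ (Fin.castAdd t i₀))) _).trans (by linarith)
    revert hclose
    rw [imp_false, not_le]
    refine Fin.addCases (fun j => ?_) (fun j => ?_) j
    · simp only [P, Fin.append_left, hφ]
      exact hε.trans_le (le_abs_chebyshevParam_sub hr j)
    · simp only [P, Fin.append_right]
      norm_num [abs_of_neg]
      linarith
  · refine (tsum_pbdPower_sub_le _ _ k).trans (ENNReal.ofReal_le_ofReal ?_)
    rw [hpow, hpow]
    refine (coeffNorm_bernoulliPGF_append_sub_le _ _ _ fun _ => ⟨by positivity, ?_⟩).trans ?_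
    · exact pow_le_one₀ (by norm_num) (by norm_num)
    · exact coeffNorm_bernoulliPGF_pow_sub_le (habs 0) (habs φ)
        (fun l hl => (sum_chebyshevParam_pow_eq φ hl).symm) k.pos

theorem theorem3 :
    ∃ c > (0 : ℝ), ∃ ε₀ > (0 : ℝ), ∀ ε : ℝ, 0 < ε → ε ≤ ε₀ → ∀ n : ℕ, 1 / ε ≤ n →
      ∀ (Ω : Type*) [MeasurableSpace Ω] (P : Measure Ω) [IsProbabilityMeasure P]
        (L : PowerLearner Ω n) (N : ℕ),
        (∀ p : Fin n → I, (∀ i, 0 < p i ∧ p i < 1) → 2 / 3 ≤ L.successProb P N ε p) →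
          (2 : ℝ) ^ (c / ε) ≤ N := by
  refine ⟨1 / 100, by norm_num, 1 / 200, by norm_num, ?_⟩
  intro ε hε hε₀ n hn Ω _ P _ L N hL
  -- The largest `r` up to `1 / (100 ε)` keeps the gap `1 / (48 r)` of the construction above `2 ε`.
  obtain ⟨r, hr⟩ : ∃ r, r = ⌊1 / (100 * ε)⌋₊ := ⟨_, rfl⟩
  have hx : 2 ≤ 1 / (100 * ε) := by rw [le_div_iff₀ (by positivity)]; linarith
  have hr2 : 2 ≤ r := by rw [hr]; exact Nat.le_floor (by exact_mod_cast hx)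
  have hr2' : (2 : ℝ) ≤ r := by exact_mod_cast hr2
  have hle : (r : ℝ) ≤ 1 / (100 * ε) := by rw [hr]; exact Nat.floor_le (by positivity)
  have hlt : 1 / (100 * ε) < r + 1 := by rw [hr]; exact Nat.lt_floor_add_one _
  have hrε : r * ε ≤ 1 / 100 := by
    calc r * ε ≤ 1 / (100 * ε) * ε := by gcongr
      _ = 1 / 100 := by field_simp
  have hinv : 1 / (100 * ε) = 1 / 100 / ε := by field_simp
  have hinv' : 1 / (100 * ε) = 1 / 100 * (1 / ε) := by field_simp
  have hn4 : 4 * r ≤ n := by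
    have : (4 * r : ℝ) ≤ n := by linarith
    exact_mod_cast this
  obtain ⟨p, q, hp, hq, hpq, hδ⟩ := exists_indistinguishable_params (ε := ε) (by omega) hn4
    (by rw [lt_div_iff₀ (by positivity)]; nlinarith) (by linarith)
  have h := (add_le_add (hL p hp) (hL q hq)).trans (L.successProb_add_le P p q hδ N hpq)
  have hreal : (4 / 3 : ℝ) ≤ 1 + N * (2 * (1 / 2) ^ (4 * r)) := by
    have h23 : (2 / 3 : ℝ≥0∞) = ENNReal.ofReal (2 / 3) := by
      rw [ENNReal.ofReal_div_of_pos (by norm_num)]; norm_num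
    rw [h23, ← ENNReal.ofReal_add (by norm_num) (by norm_num), ← ENNReal.ofReal_natCast,
      ← ENNReal.ofReal_mul (by positivity), ← ENNReal.ofReal_one,
      ← ENNReal.ofReal_add (by norm_num) (by positivity),
      ENNReal.ofReal_le_ofReal_iff (by positivity)] at h
    linarith
  calc (2 : ℝ) ^ (1 / 100 / ε) ≤ 2 ^ ((r + 1 : ℕ) : ℝ) :=
        Real.rpow_le_rpow_of_exponent_le (by norm_num) (by push_cast; linarith)
    _ = 2 ^ (r + 1) := Real.rpow_natCast _ _
    _ ≤ 2 ^ (4 * r - 3) := pow_le_pow_right₀ (by norm_num) (by omega)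
    _ ≤ N := by
      have hpos : (0 : ℝ) < 2 ^ (4 * r - 3) := by positivity
      have h8 : (2 : ℝ) ^ (4 * r) = 8 * 2 ^ (4 * r - 3) := by
        rw [show 4 * r = 3 + (4 * r - 3) by omega, pow_add, Nat.add_sub_cancel_left]; norm_num
      have h4 : N * (2 * (1 / (8 * 2 ^ (4 * r - 3)))) = N / (2 : ℝ) ^ (4 * r - 3) / 4 := by
        field_simp
        ring
      rw [one_div_pow, h8, h4] at hreal
      exact (one_le_div hpos).1 (by linarith)
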